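/- Let $G$ be a compact Hausdorff topological group with a countable basis, let $-\mathbb N=\{0,-1,-2,\dots\}$, and let $(\mu_k)_{k\in-\mathbb N}$ be a family of Borel probability laws on $G$. Convergence of laws is weak convergence, $*$ is convolution, $\delta_g$ is the point mass at $g$; for a compact subgroup $H$ of $G$, $\omega_H$ denotes the normalized Haar measure on $H$, regarded as a law on $G$, and $G/H$ the space of left cosets $gH$ with the quotient topology. There exist a sequence $(\lambda_k)_{k\in-\mathbb N}$ of probability laws on $G$, a sequence $(\alpha_l)_{l\in-\mathbb N}$ of elements of $G$, and a compact subgroup $H$ of $G$ such that - (I1) $\mu_k*\mu_{k-1}*\cdots*\mu_l*\delta_{\alpha_l}\to\lambda_k$ as $l\to-\infty$, for each $k\in-\mathbb N$; - (I2) $\delta_{\alpha_l^{-1}}*\lambda_{l-1}\to\omega_H$ as $l\to-\infty$; - (I3) $\lambda_k*\delta_h=\lambda_k$ for each $h\in H$ and each $k\in-\mathbb N$; - (I4) if $(\xi_k)_{k\in-\mathbb N}$ are independent $G$-valued random variables such that each $\xi_k$ has law $\mu_k$, then for each $k\in-\mathbb N$ the sequence $\xi_k\xi_{k-1}\cdots\xi_l\,\alpha_l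 H$ converges almost surely in $G/H$ as $l\to-\infty$. Moreover, if $((\lambda_k),(\alpha_l),H)$ and $((\tilde\lambda_k),(\tilde\alpha_l),\tilde H)$ both satisfy (I1)-(I4), then $$\tilde\lambda_k=\lambda_k*\delta_g\quad(k\in-\mathbb N),\qquad \tilde H=g^{-1}Hg$$ for every accumulation point $g$ of the sequence $(\alpha_l^{-1}\tilde\alpha_l)$ as $l\to-\infty$ (that is, every limit of a subsequence along some $l(j)\to-\infty$). -/

import Mathlib

universe u v

open MeasureTheory ProbabilityTheory Filter Topology TopologicalSpace

/-! The index set `{0, -1, -2, …}` is represented by `ℕ` through `k = -n`: the term with index `-n` of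
a sequence is its value at `n : ℕ`, the index `k - 1` becomes `n + 1`, and the limit `l → -∞` becomes
a limit along `atTop`. -/

namespace InfiniteConvolution

noncomputable section

section Products

variable {G : Type u} [Group G]

/-- The ordered product `x_n x_{n+1} ⋯ x_{n+j}`, that is, `x_k x_{k-1} ⋯ x_l` for
`k = -n` and `l = -(n + j)`. -/
def partialProd (x : ℕ → G) (n : ℕ) : ℕ → G
  | 0 => x n
  | j + 1 => partialProd x n j * x (n + (j + 1))

variable [MeasurableSpace G] [MeasurableMul₂ G]

/-- The convolution of two probability laws on `G`. -/
def conv (μ ν : ProbabilityMeasure G) : ProbabilityMeasure G :=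
  ⟨Measure.mconv (μ : Measure G) (ν : Measure G), inferInstance⟩

/-- The ordered convolution `μ_n * μ_{n+1} * ⋯ * μ_{n+j}`, that is, `μ_k * μ_{k-1} * ⋯ * μ_l` for
`k = -n` and `l = -(n + j)`. -/
def partialConv (μ : ℕ → ProbabilityMeasure G) (n : ℕ) : ℕ → ProbabilityMeasure G
  | 0 => μ n
  | j + 1 => conv (partialConv μ n j) (μ (n + (j + 1)))

end Products

section Limits

variable {G : Type u} [Group G] [TopologicalSpace G] [IsTopologicalGroup G]
  [MeasurableSpace G] [BorelSpace G]

/-- The normalized Haar measure `ω_H` of a compact subgroup `H`, as a probability law on `G`. -/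
def haarLaw (H : Subgroup G) (hH : IsCompact (H : Set G)) : ProbabilityMeasure G :=
  haveI : CompactSpace H := isCompact_iff_compactSpace.mp hH
  ⟨(Measure.haarMeasure (⊤ : PositiveCompacts H)).map (Subtype.val : H → G), by
    have : IsProbabilityMeasure (Measure.haarMeasure (⊤ : PositiveCompacts H)) :=
      ⟨by simpa using Measure.haarMeasure_self (K₀ := (⊤ : PositiveCompacts H))⟩
    exact Measure.isProbabilityMeasure_map measurable_subtype_coe.aemeasurable⟩

/-- The laws `lam k`, the elements `α l` and the compact subgroup `H` describe the limits of the
infinite convolution products of `μ`. -/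
structure IsLimitTriple [SecondCountableTopology G] (μ lam : ℕ → ProbabilityMeasure G) (α : ℕ → G)
    (H : Subgroup G) : Prop where
  isCompact : IsCompact (H : Set G)
  /-- `μ_k * μ_{k-1} * ⋯ * μ_l * δ_{α_l} → λ_k` weakly as `l → -∞`. -/
  tendsto_conv : ∀ n : ℕ,
    Tendsto (fun j : ℕ => conv (partialConv μ n j) (diracProba (α (n + j)))) atTop (𝓝 (lam n))
  /-- `δ_{α_l⁻¹} * λ_{l-1} → ω_H` weakly as `l → -∞`. -/
  tendsto_haar :
    Tendsto (fun m : ℕ => conv (diracProba (α m)⁻¹) (lam (m + 1))) atTop (𝓝 (haarLaw H isCompact))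
  /-- `λ_k * δ_h = λ_k` for `h ∈ H`. -/
  conv_dirac : ∀ n : ℕ, ∀ h ∈ H, conv (lam n) (diracProba h) = lam n
  /-- For independent `ξ_k` with laws `μ_k`, the cosets `ξ_k ξ_{k-1} ⋯ ξ_l α_l H` converge
  almost surely in `G/H` as `l → -∞`. -/
  ae_tendsto : ∀ (Ω : Type v) [MeasurableSpace Ω] (P : Measure Ω) [IsProbabilityMeasure P]
    (ξ : ℕ → Ω → G), (∀ n, Measurable (ξ n)) → iIndepFun ξ P →
    (∀ n, P.map (ξ n) = (μ n : Measure G)) →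
    ∀ n : ℕ, ∀ᵐ ω ∂P, ∃ x : G ⧸ H,
      Tendsto (fun j : ℕ => ((partialProd (fun i => ξ i ω) n j * α (n + j) : G) : G ⧸ H))
        atTop (𝓝 x)

end Limits

end

end InfiniteConvolution

/-! Along an ultrafilter the convolutions `μ_n * ⋯ * μ_l` have limits `lam n`, which solve
`lam n = μ_n * lam (n + 1)`, and the laws `lam p` in turn have a limit `ν`. Then
`lam n * ν = lam n`, so `ν` is idempotent, hence the Haar law `ω_H` of a compact subgroup `H`.
Every other limit point of the laws `lam p` is a translate `δ_a * ω_H`, because it is invariant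
under `H` on the right and some law convolved with it gives `ω_H`; translating by suitable `α_m`
therefore turns limits along ultrafilters into limits of sequences.

The almost sure convergence is martingale convergence. For continuous `f` on `G`, the mean of
`f (ξ_n ⋯ ξ_l y)` over a `lam (l + 1)`-distributed `y` is a bounded martingale in `l`. If `f` is
right `H`-invariant, it differs from `f (ξ_n ⋯ ξ_l α_l)` by a quantity tending uniformly to `0`, and
countably many such `f` separate the points of `G/H`. -/

namespace InfiniteConvolution

local notation:70 μ:70 "⋆" ν:71 => conv μ ν
local notation "δ" => diracProba

section Convolution

variable {G : Type*} [Group G] [MeasurableSpace G] [MeasurableMul₂ G] {μ ν κ : ProbabilityMeasure G}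

lemma conv_assoc (μ ν κ : ProbabilityMeasure G) : μ ⋆ ν ⋆ κ = μ ⋆ (ν ⋆ κ) :=
  Subtype.ext (Measure.mconv_assoc _ _ _)

lemma dirac_one_conv (μ : ProbabilityMeasure G) : δ 1 ⋆ μ = μ :=
  Subtype.ext (Measure.dirac_one_mconv _)

lemma conv_dirac_one (μ : ProbabilityMeasure G) : μ ⋆ δ 1 = μ :=
  Subtype.ext (Measure.mconv_dirac_one _)

lemma dirac_conv_dirac (x y : G) : δ x ⋆ δ y = δ (x * y) :=
  Subtype.ext (Measure.dirac_mconv_dirac x y)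

lemma dirac_conv_dirac_conv (x y : G) (μ : ProbabilityMeasure G) :
    δ x ⋆ (δ y ⋆ μ) = δ (x * y) ⋆ μ := by
  rw [← conv_assoc, dirac_conv_dirac]

lemma dirac_inv_conv_cancel_left (x : G) (μ : ProbabilityMeasure G) : δ x⁻¹ ⋆ (δ x ⋆ μ) = μ := by
  rw [dirac_conv_dirac_conv, inv_mul_cancel, dirac_one_conv]

lemma conv_dirac_inv_cancel_right (μ : ProbabilityMeasure G) (x : G) : μ ⋆ δ x ⋆ δ x⁻¹ = μ := by
  rw [conv_assoc, dirac_conv_dirac, mul_inv_cancel, conv_dirac_one]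

lemma toMeasure_dirac_conv (x : G) (ν : ProbabilityMeasure G) :
    (δ x ⋆ ν : Measure G) = (ν : Measure G).map (x * ·) :=
  Measure.dirac_mconv x (ν : Measure G)

lemma toMeasure_conv_dirac (ν : ProbabilityMeasure G) (x : G) :
    (ν ⋆ δ x : Measure G) = (ν : Measure G).map (· * x) :=
  Measure.mconv_dirac (ν : Measure G) x

lemma ae_conv_iff {p : G → Prop} (hp : MeasurableSet {x | p x}) :
    (∀ᵐ z ∂(μ ⋆ ν : Measure G), p z) ↔
      ∀ᵐ x ∂(μ : Measure G), ∀ᵐ y ∂(ν : Measure G), p (x * y) :=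
  (ae_map_iff measurable_mul.aemeasurable hp).trans
    (Measure.ae_prod_iff_ae_ae (p := fun z : G × G => p (z.1 * z.2)) (measurable_mul hp))

lemma ae_dirac_conv_iff {x : G} {p : G → Prop} (hp : MeasurableSet {x | p x}) :
    (∀ᵐ z ∂(δ x ⋆ ν : Measure G), p z) ↔ ∀ᵐ y ∂(ν : Measure G), p (x * y) := by
  rw [toMeasure_dirac_conv, ae_map_iff (measurable_const_mul x).aemeasurable hp]

lemma conv_eq_right_of_ae_dirac_conv_eq (h : ∀ᵐ x ∂(ν : Measure G), δ x ⋆ κ = κ) :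
    ν ⋆ κ = κ := by
  refine Subtype.ext (Measure.ext_of_lintegral _ fun f hf => ?_)
  calc ∫⁻ z, f z ∂(ν ⋆ κ : Measure G)
      = ∫⁻ x, ∫⁻ y, f (x * y) ∂(κ : Measure G) ∂(ν : Measure G) := Measure.lintegral_mconv hf
    _ = ∫⁻ _, ∫⁻ z, f z ∂(κ : Measure G) ∂(ν : Measure G) := by
        refine lintegral_congr_ae (h.mono fun x hx => ?_)
        dsimp only
        rw [← lintegral_map hf (measurable_const_mul x), ← toMeasure_dirac_conv, hx]
    _ = ∫⁻ z, f z ∂(κ : Measure G) := by simp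

lemma conv_eq_left_of_ae_conv_dirac_eq (h : ∀ᵐ y ∂(ν : Measure G), κ ⋆ δ y = κ) :
    κ ⋆ ν = κ := by
  refine Subtype.ext (Measure.ext_of_lintegral _ fun f hf => ?_)
  calc ∫⁻ z, f z ∂(κ ⋆ ν : Measure G)
      = ∫⁻ x, ∫⁻ y, f (x * y) ∂(ν : Measure G) ∂(κ : Measure G) := Measure.lintegral_mconv hf
    _ = ∫⁻ y, ∫⁻ x, f (x * y) ∂(κ : Measure G) ∂(ν : Measure G) :=
        lintegral_lintegral_swap (hf.comp measurable_mul).aemeasurable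
    _ = ∫⁻ _, ∫⁻ z, f z ∂(κ : Measure G) ∂(ν : Measure G) := by
        refine lintegral_congr_ae (h.mono fun y hy => ?_)
        dsimp only
        rw [← lintegral_map hf (measurable_mul_const y), ← toMeasure_conv_dirac, hy]
    _ = ∫⁻ z, f z ∂(κ : Measure G) := by simp

/-- The subgroup of all `x` such that left translation by `x` preserves the law `ν`. It recovers
`H` from `ω_H`, and it is the subgroup carrying `ν` when `ν` is idempotent. -/
def leftStabilizer (ν : ProbabilityMeasure G) : Subgroup G where
  carrier := {x | δ x ⋆ ν = ν}
  mul_mem' {x y} (hx : _ = _) (hy : _ = _) := by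
    rw [Set.mem_ofPred_eq, ← dirac_conv_dirac_conv, hy, hx]
  one_mem' := dirac_one_conv ν
  inv_mem' {x} (hx : _ = _) := by
    rw [Set.mem_ofPred_eq]
    conv_lhs => rw [← hx]
    exact dirac_inv_conv_cancel_left x ν

lemma mem_leftStabilizer {x : G} : x ∈ leftStabilizer ν ↔ δ x ⋆ ν = ν := Iff.rfl

lemma mem_leftStabilizer_dirac_conv {g x : G} :
    x ∈ leftStabilizer (δ g ⋆ ν) ↔ g⁻¹ * x * g ∈ leftStabilizer ν := by
  have h : g * (g⁻¹ * x * g) = x * g := by group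
  rw [mem_leftStabilizer, mem_leftStabilizer, dirac_conv_dirac_conv, ← h, ← dirac_conv_dirac_conv]
  exact (Function.LeftInverse.injective (dirac_inv_conv_cancel_left g)).eq_iff

lemma leftStabilizer_conv_dirac (ν : ProbabilityMeasure G) (g : G) :
    leftStabilizer (ν ⋆ δ g) = leftStabilizer ν := by
  ext x
  rw [mem_leftStabilizer, mem_leftStabilizer, ← conv_assoc]
  exact (Function.LeftInverse.injective (g := (· ⋆ δ g⁻¹))
    fun κ => conv_dirac_inv_cancel_right κ g).eq_iff

end Convolution

section WeakTopology

variable {G : Type*} [Group G] [TopologicalSpace G] [IsTopologicalGroup G]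
  [SecondCountableTopology G] [MeasurableSpace G] [BorelSpace G]

lemma continuous_conv :
    Continuous fun p : ProbabilityMeasure G × ProbabilityMeasure G => p.1 ⋆ p.2 :=
  (ProbabilityMeasure.continuous_map continuous_mul).comp ProbabilityMeasure.continuous_prod

lemma tendsto_conv_nhds {ι : Type*} {F : Filter ι} {f g : ι → ProbabilityMeasure G}
    {μ ν : ProbabilityMeasure G} (hf : Tendsto f F (𝓝 μ)) (hg : Tendsto g F (𝓝 ν)) :
    Tendsto (fun i => f i ⋆ g i) F (𝓝 (μ ⋆ ν)) :=
  (continuous_conv.tendsto (μ, ν)).comp (hf.prodMk_nhds hg)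

omit [Group G] [IsTopologicalGroup G] [SecondCountableTopology G] in
lemma tendsto_dirac {ι : Type*} {F : Filter ι} {f : ι → G} {x : G} (hf : Tendsto f F (𝓝 x)) :
    Tendsto (fun i => δ (f i)) F (𝓝 (δ x)) :=
  (continuous_diracProba.tendsto x).comp hf

lemma continuous_dirac_conv (ν : ProbabilityMeasure G) : Continuous fun x : G => δ x ⋆ ν :=
  continuous_conv.comp (continuous_diracProba.prodMk continuous_const)

lemma isClosed_leftStabilizer (ν : ProbabilityMeasure G) :
    IsClosed (leftStabilizer ν : Set G) :=
  isClosed_eq (continuous_dirac_conv ν) continuous_const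

end WeakTopology

section HaarLaw

variable {G : Type*} [Group G] [TopologicalSpace G] [IsTopologicalGroup G] [T2Space G]
  [MeasurableSpace G] [BorelSpace G] {H : Subgroup G}

lemma ae_mem_haarLaw (hH : IsCompact (H : Set G)) : ∀ᵐ x ∂(haarLaw H hH : Measure G), x ∈ H :=
  (ae_map_iff measurable_subtype_coe.aemeasurable (p := (· ∈ H)) hH.measurableSet).2
    (ae_of_all _ fun x => x.2)

omit [T2Space G] in
lemma subset_of_ae_mem_haarLaw (hH : IsCompact (H : Set G)) {C : Set G} (hC : IsClosed C)
    (h : ∀ᵐ x ∂(haarLaw H hH : Measure G), x ∈ C) : (H : Set G) ⊆ C := by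
  have : CompactSpace H := isCompact_iff_compactSpace.mp hH
  have hdense : Dense {x : H | (x : G) ∈ C} := Measure.dense_of_ae
    ((ae_map_iff measurable_subtype_coe.aemeasurable (p := (· ∈ C)) hC.measurableSet).1 h)
  have huniv := (hC.preimage continuous_subtype_val).closure_eq.symm.trans hdense.closure_eq
  exact fun x hx => huniv.ge (Set.mem_univ (⟨x, hx⟩ : H))

variable [SecondCountableTopology G]

omit [T2Space G] in
lemma dirac_conv_haarLaw (hH : IsCompact (H : Set G)) {h : G} (hh : h ∈ H) :
    δ h ⋆ haarLaw H hH = haarLaw H hH := by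
  have : CompactSpace H := isCompact_iff_compactSpace.mp hH
  refine Subtype.ext ((toMeasure_dirac_conv h _).trans ?_)
  change (Measure.map Subtype.val (Measure.haarMeasure ⊤)).map (h * ·) =
    Measure.map Subtype.val (Measure.haarMeasure (⊤ : PositiveCompacts H))
  have hcomm : (h * ·) ∘ (Subtype.val : H → G) = Subtype.val ∘ ((⟨h, hh⟩ : H) * ·) := rfl
  rw [Measure.map_map (measurable_const_mul h) measurable_subtype_coe, hcomm,
    ← Measure.map_map measurable_subtype_coe (measurable_const_mul _), map_mul_left_eq_self]

lemma map_mul_right_haarMeasure_top {K : Type*} [Group K] [TopologicalSpace K]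
    [IsTopologicalGroup K] [CompactSpace K] [MeasurableSpace K] [BorelSpace K] (k : K) :
    (Measure.haarMeasure (⊤ : PositiveCompacts K)).map (· * k) = Measure.haarMeasure ⊤ := by
  have : IsProbabilityMeasure (Measure.haarMeasure (⊤ : PositiveCompacts K)) :=
    ⟨by simpa using Measure.haarMeasure_self (K₀ := (⊤ : PositiveCompacts K))⟩
  have : IsProbabilityMeasure ((Measure.haarMeasure (⊤ : PositiveCompacts K)).map (· * k)) :=
    Measure.isProbabilityMeasure_map (measurable_mul_const k).aemeasurable
  exact Measure.isHaarMeasure_eq_of_isProbabilityMeasure _ _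

omit [T2Space G] in
lemma haarLaw_conv_dirac (hH : IsCompact (H : Set G)) {h : G} (hh : h ∈ H) :
    haarLaw H hH ⋆ δ h = haarLaw H hH := by
  have : CompactSpace H := isCompact_iff_compactSpace.mp hH
  refine Subtype.ext ((toMeasure_conv_dirac _ h).trans ?_)
  change (Measure.map Subtype.val (Measure.haarMeasure ⊤)).map (· * h) =
    Measure.map Subtype.val (Measure.haarMeasure (⊤ : PositiveCompacts H))
  have hcomm : (· * h) ∘ (Subtype.val : H → G) = Subtype.val ∘ (· * (⟨h, hh⟩ : H)) := rfl
  rw [Measure.map_map (measurable_mul_const h) measurable_subtype_coe, hcomm,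
    ← Measure.map_map measurable_subtype_coe (measurable_mul_const _),
    map_mul_right_haarMeasure_top]

lemma eq_haarLaw_of_dirac_conv_eq (hH : IsCompact (H : Set G)) {ν : ProbabilityMeasure G}
    (hν : ∀ᵐ x ∂(ν : Measure G), x ∈ H) (hinv : ∀ h ∈ H, δ h ⋆ ν = ν) : ν = haarLaw H hH := by
  calc ν = haarLaw H hH ⋆ ν :=
        (conv_eq_right_of_ae_dirac_conv_eq ((ae_mem_haarLaw hH).mono hinv)).symm
    _ = haarLaw H hH :=
        conv_eq_left_of_ae_conv_dirac_eq (hν.mono fun _ => haarLaw_conv_dirac hH)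

lemma eq_haarLaw_of_conv_dirac_eq (hH : IsCompact (H : Set G)) {ν : ProbabilityMeasure G}
    (hν : ∀ᵐ x ∂(ν : Measure G), x ∈ H) (hinv : ∀ h ∈ H, ν ⋆ δ h = ν) : ν = haarLaw H hH := by
  calc ν = ν ⋆ haarLaw H hH :=
        (conv_eq_left_of_ae_conv_dirac_eq ((ae_mem_haarLaw hH).mono hinv)).symm
    _ = haarLaw H hH :=
        conv_eq_right_of_ae_dirac_conv_eq (hν.mono fun _ => dirac_conv_haarLaw hH)

lemma ae_mem_of_conv_haarLaw_eq (hH : IsCompact (H : Set G)) {ν : ProbabilityMeasure G}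
    (h : ν ⋆ haarLaw H hH = haarLaw H hH) : ∀ᵐ x ∂(ν : Measure G), x ∈ H := by
  have hae := (ae_conv_iff (p := (· ∈ H)) hH.measurableSet).1 (h.symm ▸ ae_mem_haarLaw hH)
  filter_upwards [hae] with x hx
  obtain ⟨y, hxy, hy⟩ := (hx.and (ae_mem_haarLaw hH)).exists
  exact (H.mul_mem_cancel_right hy).1 hxy

lemma exists_dirac_conv_eq_haarLaw (hH : IsCompact (H : Set G)) {A B : ProbabilityMeasure G}
    (hAB : A ⋆ B = haarLaw H hH) (hB : ∀ h ∈ H, B ⋆ δ h = B) :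
    ∃ a, δ a ⋆ B = haarLaw H hH := by
  have hae := (ae_conv_iff (p := (· ∈ H)) hH.measurableSet).1 (hAB.symm ▸ ae_mem_haarLaw hH)
  obtain ⟨a, ha⟩ := hae.exists
  refine ⟨a, eq_haarLaw_of_conv_dirac_eq hH
    ((ae_dirac_conv_iff (p := (· ∈ H)) hH.measurableSet).2 ha) ?_⟩
  exact fun h hh => by rw [conv_assoc, hB h hh]

lemma leftStabilizer_haarLaw (hH : IsCompact (H : Set G)) :
    leftStabilizer (haarLaw H hH) = H := by
  ext h
  refine ⟨fun hh => ?_, dirac_conv_haarLaw hH⟩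
  have hae := (ae_dirac_conv_iff (p := (· ∈ H)) hH.measurableSet).1
    ((mem_leftStabilizer.1 hh).symm ▸ ae_mem_haarLaw hH)
  obtain ⟨y, hhy, hy⟩ := (hae.and (ae_mem_haarLaw hH)).exists
  exact (H.mul_mem_cancel_right hy).1 hhy

end HaarLaw

section ConvolutionOperator

variable {G : Type*} [TopologicalSpace G] [CompactSpace G] [MeasurableSpace G] [BorelSpace G]

lemma integrable_continuousMap (ν : ProbabilityMeasure G) (f : C(G, ℝ)) :
    Integrable f (ν : Measure G) :=
  f.continuous.integrable_of_hasCompactSupport (HasCompactSupport.of_compactSpace f)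

lemma continuous_integral (f : C(G, ℝ)) :
    Continuous fun ν : ProbabilityMeasure G => ∫ x, f x ∂(ν : Measure G) :=
  continuous_iff_continuousAt.2 fun _ =>
    ProbabilityMeasure.tendsto_iff_forall_integral_tendsto.1 tendsto_id
      (BoundedContinuousFunction.mkOfCompact f)

variable [Group G] [IsTopologicalGroup G] [SecondCountableTopology G]

omit [CompactSpace G] in
lemma ext_of_integral {μ ν : ProbabilityMeasure G}
    (h : ∀ f : C(G, ℝ), ∫ x, f x ∂(μ : Measure G) = ∫ x, f x ∂(ν : Measure G)) : μ = ν :=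
  Subtype.ext (ext_of_forall_integral_eq_of_IsFiniteMeasure
    (μ := (μ : Measure G)) (ν := (ν : Measure G)) fun f => h f.toContinuousMap)

omit [CompactSpace G] in
lemma integral_dirac_conv (x : G) (ν : ProbabilityMeasure G) (f : C(G, ℝ)) :
    ∫ z, f z ∂(δ x ⋆ ν : Measure G) = ∫ y, f (x * y) ∂(ν : Measure G) := by
  rw [toMeasure_dirac_conv, integral_map (measurable_const_mul x).aemeasurable
    f.continuous.measurable.aestronglyMeasurable]

lemma continuous_integral_mul (f : C(G, ℝ)) :
    Continuous fun p : ProbabilityMeasure G × G => ∫ y, f (p.2 * y) ∂(p.1 : Measure G) := by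
  simp only [← integral_dirac_conv]
  exact (continuous_integral f).comp
    (continuous_conv.comp ((continuous_diracProba.comp continuous_snd).prodMk continuous_fst))

/-- The convolution operator `f ↦ (x ↦ ∫ f (x y) dν(y))` on `C(G, ℝ)`, that is, the transition
operator of the random walk on `G` whose steps multiply on the right by a `ν`-distributed element.
-/
noncomputable def convOp (ν : ProbabilityMeasure G) (f : C(G, ℝ)) : C(G, ℝ) where
  toFun x := ∫ y, f (x * y) ∂(ν : Measure G)
  continuous_toFun := (continuous_integral_mul f).comp (Continuous.prodMk_right ν)

variable {μ ν : ProbabilityMeasure G} {f : C(G, ℝ)}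

lemma convOp_apply (ν : ProbabilityMeasure G) (f : C(G, ℝ)) (x : G) :
    convOp ν f x = ∫ y, f (x * y) ∂(ν : Measure G) := rfl

lemma norm_convOp_le (ν : ProbabilityMeasure G) (f : C(G, ℝ)) : ‖convOp ν f‖ ≤ ‖f‖ :=
  (ContinuousMap.norm_le _ (norm_nonneg f)).2 fun x => by
    simpa [convOp_apply] using norm_integral_le_of_norm_le_const (μ := (ν : Measure G))
      (ae_of_all _ fun y => f.norm_coe_le_norm (x * y))

lemma continuous_convOp (f : C(G, ℝ)) : Continuous fun ν : ProbabilityMeasure G => convOp ν f :=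
  ContinuousMap.continuous_of_continuous_uncurry _ (continuous_integral_mul f)

lemma integral_convOp (μ ν : ProbabilityMeasure G) (f : C(G, ℝ)) :
    ∫ x, convOp ν f x ∂(μ : Measure G) = ∫ z, f z ∂(μ ⋆ ν : Measure G) :=
  (integral_mconv (integrable_continuousMap (μ ⋆ ν) f)).symm

lemma convOp_dirac_conv (a : G) (ν : ProbabilityMeasure G) (f : C(G, ℝ)) (x : G) :
    convOp (δ a ⋆ ν) f x = convOp ν f (x * a) := by
  simp only [convOp_apply, mul_assoc]
  exact integral_dirac_conv a ν (f.comp ⟨(x * ·), continuous_const_mul x⟩)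

lemma convOp_conv (μ ν : ProbabilityMeasure G) (f : C(G, ℝ)) :
    convOp (μ ⋆ ν) f = convOp μ (convOp ν f) := by
  ext x
  calc convOp (μ ⋆ ν) f x = ∫ z, f z ∂(δ x ⋆ μ ⋆ ν : Measure G) := by
        rw [convOp_apply, ← integral_dirac_conv, conv_assoc]
    _ = ∫ y, convOp ν f y ∂(δ x ⋆ μ : Measure G) := (integral_convOp _ _ _).symm
    _ = convOp μ (convOp ν f) x := integral_dirac_conv x μ (convOp ν f)

lemma mem_leftStabilizer_iff_convOp {x : G} :
    x ∈ leftStabilizer ν ↔ ∀ f : C(G, ℝ), convOp ν f x = convOp ν f 1 := by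
  have hconv (f : C(G, ℝ)) (y : G) : convOp ν f y = ∫ z, f z ∂(δ y ⋆ ν : Measure G) :=
    (integral_dirac_conv y ν f).symm
  simp only [hconv, dirac_one_conv, mem_leftStabilizer]
  exact ⟨fun h f => by rw [h], ext_of_integral⟩

lemma integral_sq_sub_of_convOp_eq_self (hf : convOp ν f = f) (x : G) :
    ∫ y, (f (x * y) - f x) ^ 2 ∂(ν : Measure G) = convOp ν (f ^ 2) x - f x ^ 2 := by
  let g : C(G, ℝ) := f.comp ⟨(x * ·), continuous_const_mul x⟩
  have hg : ∫ y, g y ∂(ν : Measure G) = f x := DFunLike.congr_fun hf x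
  calc ∫ y, (f (x * y) - f x) ^ 2 ∂(ν : Measure G)
      = ∫ y, ((g ^ 2) y - (2 * f x) * g y + f x ^ 2) ∂(ν : Measure G) := by
        refine integral_congr_ae (ae_of_all _ fun y => ?_)
        simp only [g, ContinuousMap.pow_apply, ContinuousMap.comp_apply, ContinuousMap.coe_mk]
        ring
    _ = convOp ν (f ^ 2) x - (2 * f x) * f x + f x ^ 2 := by
        rw [integral_add, integral_sub, integral_const_mul, hg, integral_const]
        · simp [g, convOp_apply]
        · exact integrable_continuousMap ν _
        · exact (integrable_continuousMap ν g).const_mul _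
        · exact (integrable_continuousMap ν _).sub ((integrable_continuousMap ν g).const_mul _)
        · exact integrable_const _
    _ = convOp ν (f ^ 2) x - f x ^ 2 := by ring

lemma haarLaw_top_conv (ν : ProbabilityMeasure G) :
    haarLaw (⊤ : Subgroup G) isCompact_univ ⋆ ν = haarLaw ⊤ isCompact_univ :=
  conv_eq_left_of_ae_conv_dirac_eq (ae_of_all _ fun _ => haarLaw_conv_dirac _ trivial)

-- The variance of `f` under a step of the walk integrates to zero against the Haar law, because
-- the Haar law is stationary; being continuous and nonnegative, it vanishes everywhere.
lemma ae_mul_eq_of_convOp_eq_self (hf : convOp ν f = f) (x : G) :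
    ∀ᵐ y ∂(ν : Measure G), f (x * y) = f x := by
  let m : ProbabilityMeasure G := haarLaw ⊤ isCompact_univ
  let variance : C(G, ℝ) := convOp ν (f ^ 2) - f ^ 2
  have hvariance (x : G) : ∫ y, (f (x * y) - f x) ^ 2 ∂(ν : Measure G) = variance x :=
    integral_sq_sub_of_convOp_eq_self hf x
  have hnonneg : 0 ≤ ⇑variance := fun x => by
    rw [Pi.zero_apply, ← hvariance]
    positivity
  have hintegral : ∫ x, variance x ∂(m : Measure G) = 0 := by
    have hsub := integral_sub (integrable_continuousMap m (convOp ν (f ^ 2)))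
      (integrable_continuousMap m (f ^ 2))
    rwa [integral_convOp, haarLaw_top_conv, sub_self] at hsub
  have hae : ∀ᵐ x ∂(m : Measure G), variance x = 0 :=
    (integral_eq_zero_iff_of_nonneg hnonneg (integrable_continuousMap m variance)).1 hintegral
  have hzero : variance x = 0 := subset_of_ae_mem_haarLaw isCompact_univ
    (isClosed_eq variance.continuous continuous_const) hae (Subgroup.mem_top x)
  let increment : C(G, ℝ) := (f.comp ⟨(x * ·), continuous_const_mul x⟩ - .const G (f x)) ^ 2
  have hincrement : ∀ᵐ y ∂(ν : Measure G), increment y = 0 :=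
    (integral_eq_zero_iff_of_nonneg (fun y => sq_nonneg _)
      (integrable_continuousMap ν increment)).1 ((hvariance x).trans hzero)
  exact hincrement.mono fun y hy => sub_eq_zero.1 (pow_eq_zero_iff two_ne_zero |>.1 hy)

theorem exists_eq_haarLaw_of_conv_self_eq [T2Space G] (hν : ν ⋆ ν = ν) :
    ∃ (H : Subgroup G) (hH : IsCompact (H : Set G)), ν = haarLaw H hH := by
  have hsupport : (ν : Measure G).support ⊆ leftStabilizer ν := fun y hy =>
    mem_leftStabilizer_iff_convOp.2 fun f => by
      have hfix : convOp ν (convOp ν f) = convOp ν f := by rw [← convOp_conv, hν]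
      have hae : ∀ᵐ y ∂(ν : Measure G), convOp ν f y = convOp ν f 1 := by
        simpa only [one_mul] using ae_mul_eq_of_convOp_eq_self hfix 1
      exact Measure.support_subset_of_isClosed
        (isClosed_eq (convOp ν f).continuous continuous_const) hae hy
  have hcompact := (isClosed_leftStabilizer ν).isCompact
  exact ⟨leftStabilizer ν, hcompact, eq_haarLaw_of_dirac_conv_eq hcompact
    (mem_of_superset Measure.support_mem_ae hsupport) fun _ => mem_leftStabilizer.1⟩

end ConvolutionOperator

section ConvolutionEquation

variable {G : Type*} [Group G] [MeasurableSpace G] [MeasurableMul₂ G]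

/-- The convolution `μ_n * μ_{n+1} * ⋯ * μ_l` for `n ≤ l`, that is, `partialConv` indexed by its
last factor instead of the number of factors. For `l < n` it has the junk value `μ n`. -/
noncomputable def segConv (μ : ℕ → ProbabilityMeasure G) (n l : ℕ) : ProbabilityMeasure G :=
  partialConv μ n (l - n)

/-- Solutions of the convolution equation `λ_k = μ_k * λ_{k-1}`, in the indexing `k = -n`. -/
def IsConvSolution (μ lam : ℕ → ProbabilityMeasure G) : Prop :=
  ∀ n, lam n = μ n ⋆ lam (n + 1)

variable {μ lam : ℕ → ProbabilityMeasure G} {n l : ℕ}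

lemma segConv_self (μ : ℕ → ProbabilityMeasure G) (n : ℕ) : segConv μ n n = μ n := by
  rw [segConv, Nat.sub_self, partialConv]

lemma segConv_succ (μ : ℕ → ProbabilityMeasure G) (hnl : n ≤ l) :
    segConv μ n (l + 1) = segConv μ n l ⋆ μ (l + 1) := by
  have hindex : n + (l - n + 1) = l + 1 := by lia
  rw [segConv, Nat.succ_sub hnl, partialConv, hindex, segConv]

lemma segConv_eq_conv_segConv (μ : ℕ → ProbabilityMeasure G) (hnl : n < l) :
    segConv μ n l = μ n ⋆ segConv μ (n + 1) l := by
  induction l, hnl using Nat.le_induction with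
  | base => rw [segConv_succ μ le_rfl, segConv_self, segConv_self]
  | succ l hnl ih =>
    rw [segConv_succ μ (Nat.le_of_succ_le hnl), ih, segConv_succ μ hnl, conv_assoc]

lemma IsConvSolution.eq_segConv_conv (h : IsConvSolution μ lam) (hnl : n ≤ l) :
    lam n = segConv μ n l ⋆ lam (l + 1) := by
  induction l, hnl using Nat.le_induction with
  | base => rw [segConv_self, ← h n]
  | succ l hnl ih => rw [ih, h (l + 1), ← conv_assoc, ← segConv_succ μ hnl]

end ConvolutionEquation

section ConvolutionEquationLimits

variable {G : Type*} [Group G] [TopologicalSpace G] [IsTopologicalGroup G]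
  [SecondCountableTopology G] [MeasurableSpace G] [BorelSpace G]
  {μ lam : ℕ → ProbabilityMeasure G} {F : Filter ℕ} [F.NeBot]

lemma isConvSolution_of_tendsto (hF : F ≤ atTop) {ρ : ℕ → ProbabilityMeasure G}
    (h : ∀ n, Tendsto (fun l => segConv μ n l ⋆ ρ l) F (𝓝 (lam n))) : IsConvSolution μ lam := by
  intro n
  refine tendsto_nhds_unique (h n)
    ((tendsto_conv_nhds tendsto_const_nhds (h (n + 1))).congr' ?_)
  filter_upwards [hF (eventually_gt_atTop n)] with l hl
  rw [segConv_eq_conv_segConv μ hl, conv_assoc]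

lemma IsConvSolution.eq_conv_of_tendsto (h : IsConvSolution μ lam) (hF : F ≤ atTop) {n : ℕ}
    {β : ℕ → G} {A B : ProbabilityMeasure G}
    (hA : Tendsto (fun l => segConv μ n l ⋆ δ (β l)) F (𝓝 A))
    (hB : Tendsto (fun l => δ (β l)⁻¹ ⋆ lam (l + 1)) F (𝓝 B)) : lam n = A ⋆ B := by
  refine tendsto_nhds_unique tendsto_const_nhds ((tendsto_conv_nhds hA hB).congr' ?_)
  filter_upwards [hF (eventually_ge_atTop n)] with l hl
  calc segConv μ n l ⋆ δ (β l) ⋆ (δ (β l)⁻¹ ⋆ lam (l + 1))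
      = segConv μ n l ⋆ lam (l + 1) := by
        rw [conv_assoc, dirac_conv_dirac_conv, mul_inv_cancel, dirac_one_conv]
    _ = lam n := (h.eq_segConv_conv hl).symm

end ConvolutionEquationLimits

section ConditionalExpectation

variable {Ω A B E : Type*} {m mΩ : MeasurableSpace Ω} [MeasurableSpace A] [MeasurableSpace B]
  {P : Measure Ω} [IsFiniteMeasure P] {X : Ω → A} {Y : Ω → B}

lemma map_prodMk_restrict_of_indep (hm : m ≤ mΩ) (hX : Measurable[m] X) (hY : Measurable Y)
    (hind : Indep m (MeasurableSpace.comap Y inferInstance) P) {s : Set Ω}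
    (hs : MeasurableSet[m] s) :
    (P.restrict s).map (fun ω => (X ω, Y ω)) = ((P.restrict s).map X).prod (P.map Y) := by
  refine (Measure.prod_eq fun a b ha hb => ?_).symm
  have hX' : Measurable X := hX.mono hm le_rfl
  rw [Measure.map_apply (hX'.prodMk hY) (ha.prod hb), Measure.map_apply hX' ha,
    Measure.map_apply hY hb, Measure.restrict_apply ((hX'.prodMk hY) (ha.prod hb)),
    Measure.restrict_apply (hX' ha),
    ← (Indep_iff _ _ P).1 hind _ _ ((hX ha).inter hs) ⟨b, hb, rfl⟩, Set.inter_right_comm]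
  rfl

lemma condExp_prodMk_ae_eq_integral_of_indep [NormedAddCommGroup E] [NormedSpace ℝ E]
    [CompleteSpace E] (hm : m ≤ mΩ) (hX : Measurable[m] X) (hY : Measurable Y)
    (hind : Indep m (MeasurableSpace.comap Y inferInstance) P) {f : A × B → E}
    (hf : StronglyMeasurable f) (hint : Integrable (fun ω => f (X ω, Y ω)) P) :
    P[fun ω => f (X ω, Y ω) | m] =ᵐ[P] fun ω => ∫ y, f (X ω, y) ∂P.map Y := by
  have hX' : Measurable X := hX.mono hm le_rfl
  have hXY : Measurable fun ω => (X ω, Y ω) := hX'.prodMk hY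
  have hprod {s : Set Ω} (hs : MeasurableSet[m] s) :
      Integrable f (((P.restrict s).map X).prod (P.map Y)) := by
    rw [← map_prodMk_restrict_of_indep hm hX hY hind hs,
      integrable_map_measure hf.aestronglyMeasurable hXY.aemeasurable]
    exact hint.restrict
  have hmeas : StronglyMeasurable fun x => ∫ y, f (x, y) ∂P.map Y := hf.integral_prod_right'
  have haverage : Integrable (fun ω => ∫ y, f (X ω, y) ∂P.map Y) P := by
    simpa [Function.comp_def] using
      (hprod MeasurableSet.univ).integral_prod_left.comp_measurable hX'
  refine (ae_eq_condExp_of_forall_setIntegral_eq hm hint (fun _ _ _ => haverage.integrableOn)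
    (fun s hs _ => ?_) (hmeas.comp_measurable hX).aestronglyMeasurable).symm
  calc ∫ ω in s, ∫ y, f (X ω, y) ∂P.map Y ∂P
      = ∫ x, ∫ y, f (x, y) ∂P.map Y ∂(P.restrict s).map X :=
        (integral_map hX'.aemeasurable hmeas.aestronglyMeasurable).symm
    _ = ∫ p, f p ∂(P.restrict s).map (fun ω => (X ω, Y ω)) := by
        rw [map_prodMk_restrict_of_indep hm hX hY hind hs, integral_prod _ (hprod hs)]
    _ = ∫ ω in s, f (X ω, Y ω) ∂P :=
        integral_map hXY.aemeasurable hf.aestronglyMeasurable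

end ConditionalExpectation

section RandomWalk

variable {Ω : Type*} {m mΩ : MeasurableSpace Ω} {P : Measure Ω}

lemma indep_natural_comap_of_lt {ι β : Type*} [LinearOrder ι] [TopologicalSpace β]
    [MetrizableSpace β] [MeasurableSpace β] [BorelSpace β] {η : ι → Ω → β}
    (hη : ∀ i, StronglyMeasurable (η i)) (hind : iIndepFun η P) {i j : ι} (hij : i < j) :
    Indep (Filtration.natural η hη i) (MeasurableSpace.comap (η j) inferInstance) P := by
  have h := indep_iSup_of_disjoint (fun k => (hη k).measurable.comap_le) hind
    (S := {k | k ≤ i}) (T := {j}) (by simpa using hij)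
  rwa [iSup_singleton] at h

lemma measurable_partialProd {G : Type*} [Group G] [MeasurableSpace G] [MeasurableMul₂ G]
    {ξ : ℕ → Ω → G} {n j : ℕ} (hξ : ∀ i ≤ j, Measurable (ξ (n + i))) :
    Measurable fun ω => partialProd (fun i => ξ i ω) n j := by
  induction j with
  | zero => exact hξ 0 le_rfl
  | succ j ih => exact (ih fun i hi => hξ i (Nat.le_succ_of_le hi)).mul (hξ (j + 1) le_rfl)

variable {G : Type*} [Group G] [TopologicalSpace G] [IsTopologicalGroup G] [CompactSpace G]
  [T2Space G] [SecondCountableTopology G] [MeasurableSpace G] [BorelSpace G]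
  {μ lam : ℕ → ProbabilityMeasure G} {ξ : ℕ → Ω → G} [IsProbabilityMeasure P]

omit [T2Space G] in
lemma condExp_mul_ae_eq_convOp (hm : m ≤ mΩ) {X Y : Ω → G}
    (hX : Measurable[m] X) (hY : Measurable Y)
    (hind : Indep m (MeasurableSpace.comap Y inferInstance) P) {ν : ProbabilityMeasure G}
    (hlaw : P.map Y = (ν : Measure G)) (f : C(G, ℝ)) :
    P[fun ω => f (X ω * Y ω) | m] =ᵐ[P] fun ω => convOp ν f (X ω) := by
  have hmul : Measurable fun p : G × G => f (p.1 * p.2) :=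
    f.continuous.measurable.comp measurable_mul
  have hint : Integrable (fun ω => f (X ω * Y ω)) P :=
    .of_bound (hmul.comp ((hX.mono hm le_rfl).prodMk hY)).aestronglyMeasurable _
      (ae_of_all _ fun _ => f.norm_coe_le_norm _)
  have hcond := condExp_prodMk_ae_eq_integral_of_indep hm hX hY hind hmul.stronglyMeasurable hint
  simpa only [hlaw, ← convOp_apply] using hcond

-- By the convolution equation, the function evaluated at time `j` is the average over the next
-- factor of the one evaluated at time `j + 1`.
lemma martingale_convOp_partialProd (h : IsConvSolution μ lam) (hξ : ∀ i, Measurable (ξ i))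
    (hind : iIndepFun ξ P) (hlaw : ∀ i, P.map (ξ i) = (μ i : Measure G)) (n : ℕ) (f : C(G, ℝ)) :
    Martingale (fun j ω => convOp (lam (n + j + 1)) f (partialProd (fun i => ξ i ω) n j))
      (Filtration.natural (fun i => ξ (n + i)) fun i => (hξ (n + i)).stronglyMeasurable) P := by
  set 𝓕 := Filtration.natural (fun i => ξ (n + i)) fun i => (hξ (n + i)).stronglyMeasurable
  have hadapted (j : ℕ) : Measurable[𝓕 j] fun ω => partialProd (fun i => ξ i ω) n j :=
    measurable_partialProd fun i hi =>
      ((Filtration.stronglyAdapted_natural _ i).mono (𝓕.mono hi)).measurable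
  refine martingale_nat
    (fun j => ((convOp _ f).continuous.measurable.comp (hadapted j)).stronglyMeasurable)
    (fun j => .of_bound ((convOp _ f).continuous.measurable.comp
      ((hadapted j).mono (𝓕.le j) le_rfl)).aestronglyMeasurable _
      (ae_of_all _ fun _ => (convOp _ f).norm_coe_le_norm _)) fun j => ?_
  have hind_shift : iIndepFun (fun i => ξ (n + i)) P := hind.precomp (add_right_injective n)
  have hindep : Indep (𝓕 j) (MeasurableSpace.comap (ξ (n + (j + 1))) inferInstance) P :=
    indep_natural_comap_of_lt (η := fun i => ξ (n + i)) _ hind_shift j.lt_succ_self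
  have hnext := condExp_mul_ae_eq_convOp (𝓕.le j) (hadapted j) (hξ _) hindep (hlaw _)
    (convOp (lam (n + (j + 1) + 1)) f)
  rw [← convOp_conv, ← h (n + (j + 1))] at hnext
  exact hnext.symm

lemma ae_exists_tendsto_convOp_partialProd (h : IsConvSolution μ lam)
    (hξ : ∀ i, Measurable (ξ i)) (hind : iIndepFun ξ P)
    (hlaw : ∀ i, P.map (ξ i) = (μ i : Measure G)) (n : ℕ) (f : C(G, ℝ)) :
    ∀ᵐ ω ∂P, ∃ c : ℝ, Tendsto
      (fun j => convOp (lam (n + j + 1)) f (partialProd (fun i => ξ i ω) n j)) atTop (𝓝 c) := by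
  have hmart := martingale_convOp_partialProd h hξ hind hlaw n f
  have hbound (ν : ProbabilityMeasure G) (x : G) : ‖convOp ν f x‖ ≤ ‖f‖ :=
    ((convOp ν f).norm_coe_le_norm x).trans (norm_convOp_le ν f)
  have hlim := hmart.submartingale.ae_tendsto_limitProcess (R := ‖f‖₊) fun j => by
    refine (eLpNorm_le_of_ae_bound (ae_of_all _ fun ω => hbound _ _)).trans ?_
    simp
  exact hlim.mono fun ω hω => ⟨_, hω⟩

end RandomWalk

section Cosets

lemma exists_countable_separating (Q : Type*) [TopologicalSpace Q] [MetrizableSpace Q]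
    [SeparableSpace Q] [Nonempty Q] :
    ∃ f : ℕ → C(Q, ℝ), ∀ x y, (∀ i, f i x = f i y) → x = y := by
  let := metrizableSpaceMetric Q
  refine ⟨fun i => ⟨fun x => dist x (denseSeq Q i), by fun_prop⟩, fun x y h => ?_⟩
  have hclosed : IsClosed {q | dist x q = dist y q} := isClosed_eq (by fun_prop) (by fun_prop)
  have huniv := hclosed.closure_eq.symm.trans
    ((denseRange_denseSeq Q).mono (Set.range_subset_iff.2 h)).closure_eq
  have hyy : dist x y = dist y y := huniv.ge (Set.mem_univ y)
  rwa [dist_self, dist_eq_zero] at hyy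

lemma exists_tendsto_of_separating {ι κ Q Y : Type*} [TopologicalSpace Q] [CompactSpace Q]
    [TopologicalSpace Y] [T2Space Y] {f : ι → C(Q, Y)} (hf : ∀ x y, (∀ i, f i x = f i y) → x = y)
    {F : Filter κ} [F.NeBot] {g : κ → Q} (hg : ∀ i, ∃ c, Tendsto (fun k => f i (g k)) F (𝓝 c)) :
    ∃ x, Tendsto g F (𝓝 x) := by
  choose c hc using hg
  have hemb : IsClosedEmbedding fun x i => f i x :=
    (continuous_pi fun i => (f i).continuous).isClosedEmbedding
      fun x y hxy => hf x y (congrFun hxy)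
  have hlim : Tendsto (fun k i => f i (g k)) F (𝓝 c) := tendsto_pi_nhds.2 hc
  obtain ⟨x, rfl⟩ := hemb.isClosed_range.mem_of_tendsto hlim
    (Eventually.of_forall fun k => Set.mem_range_self (g k))
  exact ⟨x, hemb.tendsto_nhds_iff.2 hlim⟩

variable {G : Type*} [Group G] [TopologicalSpace G] [IsTopologicalGroup G] [CompactSpace G]
  [T2Space G] [SecondCountableTopology G] [MeasurableSpace G] [BorelSpace G] {H : Subgroup G}

lemma convOp_haarLaw_eq_self (hH : IsCompact (H : Set G)) {f : C(G, ℝ)}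
    (hf : ∀ x, ∀ h ∈ H, f (x * h) = f x) : convOp (haarLaw H hH) f = f := by
  ext x
  have hconst : ∀ᵐ y ∂(haarLaw H hH : Measure G), f (x * y) = f x :=
    (ae_mem_haarLaw hH).mono fun y hy => hf x y hy
  rw [convOp_apply, integral_congr_ae hconst, integral_const, probReal_univ, one_smul]

lemma tendsto_of_tendsto_convOp {ι : Type*} {F : Filter ι} (hH : IsCompact (H : Set G))
    {β : ι → G} {κ : ι → ProbabilityMeasure G}
    (hκ : Tendsto (fun i => δ (β i)⁻¹ ⋆ κ i) F (𝓝 (haarLaw H hH))) {f : C(G, ℝ)}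
    (hf : ∀ x, ∀ h ∈ H, f (x * h) = f x) {s : ι → G} {c : ℝ}
    (hs : Tendsto (fun i => convOp (κ i) f (s i)) F (𝓝 c)) :
    Tendsto (fun i => f (s i * β i)) F (𝓝 c) := by
  have huniform : Tendsto (fun i => convOp (δ (β i)⁻¹ ⋆ κ i) f) F (𝓝 f) := by
    have hlim := ((continuous_convOp f).tendsto _).comp hκ
    rwa [convOp_haarLaw_eq_self hH hf] at hlim
  have hdiff : Tendsto (fun i => f (s i * β i) - convOp (κ i) f (s i)) F (𝓝 0) := by
    refine squeeze_zero_norm (fun i => ?_) (tendsto_iff_norm_sub_tendsto_zero.1 huniform)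
    have hvalue : convOp (κ i) f (s i) = convOp (δ (β i)⁻¹ ⋆ κ i) f (s i * β i) := by
      rw [convOp_dirac_conv, mul_inv_cancel_right]
    rw [hvalue, norm_sub_rev]
    exact (convOp (δ (β i)⁻¹ ⋆ κ i) f - f).norm_coe_le_norm (s i * β i)
  simpa using hdiff.add hs

theorem ae_exists_tendsto_coset {μ lam : ℕ → ProbabilityMeasure G} {α : ℕ → G}
    (hH : IsCompact (H : Set G)) (hlam : IsConvSolution μ lam)
    (hα : Tendsto (fun m => δ (α m)⁻¹ ⋆ lam (m + 1)) atTop (𝓝 (haarLaw H hH)))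
    {Ω : Type*} [MeasurableSpace Ω] {P : Measure Ω} [IsProbabilityMeasure P] {ξ : ℕ → Ω → G}
    (hξ : ∀ n, Measurable (ξ n)) (hind : iIndepFun ξ P)
    (hlaw : ∀ n, P.map (ξ n) = (μ n : Measure G)) (n : ℕ) :
    ∀ᵐ ω ∂P, ∃ x : G ⧸ H,
      Tendsto (fun j => ((partialProd (fun i => ξ i ω) n j * α (n + j) : G) : G ⧸ H))
        atTop (𝓝 x) := by
  have : IsClosed (H : Set G) := hH.isClosed
  obtain ⟨f, hf⟩ := exists_countable_separating (G ⧸ H)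
  let F (i : ℕ) : C(G, ℝ) := (f i).comp ⟨QuotientGroup.mk, continuous_quot_mk⟩
  have hF (i : ℕ) (x : G) (h : G) (hh : h ∈ H) : F i (x * h) = F i x :=
    congrArg (f i) (QuotientGroup.mk_mul_of_mem x hh)
  have hshift : Tendsto (n + ·) atTop atTop :=
    tendsto_atTop_mono (fun j => Nat.le_add_left j n) tendsto_id
  filter_upwards [ae_all_iff.2 fun i =>
    ae_exists_tendsto_convOp_partialProd hlam hξ hind hlaw n (F i)] with ω hω
  refine exists_tendsto_of_separating hf fun i => (hω i).imp fun c hc => ?_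
  exact tendsto_of_tendsto_convOp hH (hα.comp hshift) (hF i) hc

end Cosets

section Existence

lemma exists_tendsto_ultrafilter {ι X : Type*} [TopologicalSpace X] [CompactSpace X]
    (U : Ultrafilter ι) (f : ι → X) : ∃ x, Tendsto f U (𝓝 x) :=
  ⟨_, (U.map f).le_nhds_lim⟩

-- Minimizing the distance of `φ i k` to `x` over `k` does at least as well as each of the choices
-- of `k` that work along a single ultrafilter.
lemma exists_tendsto_of_forall_ultrafilter {ι K X : Type*} [TopologicalSpace K] [CompactSpace K]
    [Nonempty K] [TopologicalSpace X] [PseudoMetrizableSpace X] {F : Filter ι} {φ : ι → K → X}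
    (hφ : ∀ i, Continuous (φ i)) {x : X}
    (h : ∀ U : Ultrafilter ι, (U : Filter ι) ≤ F → ∃ k, Tendsto (fun i => φ i k) U (𝓝 x)) :
    ∃ k : ι → K, Tendsto (fun i => φ i (k i)) F (𝓝 x) := by
  let := pseudoMetrizableSpacePseudoMetric X
  have hmin (i : ι) : ∃ k, ∀ k', dist (φ i k) x ≤ dist (φ i k') x := by
    obtain ⟨k, -, hk⟩ := isCompact_univ.exists_isMinOn Set.univ_nonempty
      ((hφ i).dist continuous_const).continuousOn
    exact ⟨k, fun k' => hk (Set.mem_univ k')⟩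
  choose k hk using hmin
  refine ⟨k, (tendsto_iff_ultrafilter _ _ _).2 fun U hU => ?_⟩
  obtain ⟨k', hk'⟩ := h U hU
  exact tendsto_iff_dist_tendsto_zero.2 (squeeze_zero (fun _ => dist_nonneg) (fun i => hk i k')
    (tendsto_iff_dist_tendsto_zero.1 hk'))

variable {G : Type*} [Group G] [TopologicalSpace G] [IsTopologicalGroup G]
  [SecondCountableTopology G] [MeasurableSpace G] [BorelSpace G]
  {V : Ultrafilter ℕ} {μ lam : ℕ → ProbabilityMeasure G} {ν : ProbabilityMeasure G}

/-- Along the ultrafilter `V`, the convolutions `μ_n * ⋯ * μ_l` converge to `lam n` as `l` varies,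
and then the laws `lam (p + 1)` converge to `ν`. Such limits exist without any centering `α`, and
`ν` turns out to be idempotent. -/
structure IsLimitAlong (V : Ultrafilter ℕ) (μ lam : ℕ → ProbabilityMeasure G)
    (ν : ProbabilityMeasure G) : Prop where
  le_atTop : (V : Filter ℕ) ≤ atTop
  tendsto_segConv : ∀ n, Tendsto (segConv μ n) V (𝓝 (lam n))
  tendsto_tail : Tendsto (fun p => lam (p + 1)) V (𝓝 ν)

namespace IsLimitAlong

lemma isConvSolution (h : IsLimitAlong V μ lam ν) : IsConvSolution μ lam :=
  isConvSolution_of_tendsto h.le_atTop (ρ := fun _ => δ 1) fun n => by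
    simpa only [conv_dirac_one] using h.tendsto_segConv n

lemma eq_conv_of_tendsto (h : IsLimitAlong V μ lam ν) {A : ℕ → ProbabilityMeasure G}
    (hA : IsConvSolution μ A) {B : ProbabilityMeasure G}
    (hB : Tendsto (fun p => A (p + 1)) V (𝓝 B)) (n : ℕ) : A n = lam n ⋆ B :=
  hA.eq_conv_of_tendsto h.le_atTop (β := fun _ => 1)
    (by simpa only [conv_dirac_one] using h.tendsto_segConv n)
    (by simpa only [inv_one, dirac_one_conv] using hB)

lemma conv_eq (h : IsLimitAlong V μ lam ν) (n : ℕ) : lam n ⋆ ν = lam n :=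
  (h.eq_conv_of_tendsto h.isConvSolution h.tendsto_tail n).symm

lemma conv_self (h : IsLimitAlong V μ lam ν) : ν ⋆ ν = ν := by
  refine tendsto_nhds_unique (tendsto_conv_nhds h.tendsto_tail tendsto_const_nhds) ?_
  simpa only [h.conv_eq] using h.tendsto_tail

variable {H : Subgroup G} {hH : IsCompact (H : Set G)}

lemma conv_dirac (h : IsLimitAlong V μ lam (haarLaw H hH)) (n : ℕ) {g : G} (hg : g ∈ H) :
    lam n ⋆ δ g = lam n := by
  rw [← h.conv_eq n, conv_assoc, haarLaw_conv_dirac hH hg]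

variable [CompactSpace G] [T2Space G]

lemma exists_of_le_atTop (hV : (V : Filter ℕ) ≤ atTop) (μ : ℕ → ProbabilityMeasure G) :
    ∃ lam ν, IsLimitAlong V μ lam ν := by
  choose lam hlam using fun n => exists_tendsto_ultrafilter V (segConv μ n)
  obtain ⟨ν, hν⟩ := exists_tendsto_ultrafilter V fun p => lam (p + 1)
  exact ⟨lam, ν, hV, hlam, hν⟩

lemma exists_conv_eq (h : IsLimitAlong V μ lam ν) {A : ℕ → ProbabilityMeasure G}
    (hA : IsConvSolution μ A) {B : ProbabilityMeasure G} (hAB : ∀ n, lam n = A n ⋆ B) :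
    ∃ C, (∀ n, A n = lam n ⋆ C) ∧ C ⋆ B = ν := by
  obtain ⟨C, hC⟩ := exists_tendsto_ultrafilter V fun p => A (p + 1)
  refine ⟨C, h.eq_conv_of_tendsto hA hC, ?_⟩
  refine tendsto_nhds_unique (tendsto_conv_nhds hC tendsto_const_nhds) ?_
  simpa only [← hAB] using h.tendsto_tail

lemma exists_tendsto_dirac_conv_ultrafilter (h : IsLimitAlong V μ lam (haarLaw H hH))
    {U : Ultrafilter ℕ} (hU : (U : Filter ℕ) ≤ atTop) :
    ∃ g, Tendsto (fun m => δ g ⋆ lam (m + 1)) U (𝓝 (haarLaw H hH)) := by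
  obtain ⟨B, hB⟩ := exists_tendsto_ultrafilter U fun m => lam (m + 1)
  obtain ⟨A, _, hA⟩ := exists_of_le_atTop hU μ
  have hAB (n : ℕ) : lam n = A n ⋆ B := hA.eq_conv_of_tendsto h.isConvSolution hB n
  obtain ⟨C, -, hCB⟩ := h.exists_conv_eq hA.isConvSolution hAB
  have hBH (g : G) (hg : g ∈ H) : B ⋆ δ g = B := by
    refine tendsto_nhds_unique (tendsto_conv_nhds hB tendsto_const_nhds) ?_
    simpa only [h.conv_dirac _ hg] using hB
  obtain ⟨g, hgB⟩ := exists_dirac_conv_eq_haarLaw hH hCB hBH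
  exact ⟨g, hgB ▸ tendsto_conv_nhds tendsto_const_nhds hB⟩

lemma exists_tendsto_dirac_conv (h : IsLimitAlong V μ lam (haarLaw H hH)) :
    ∃ α : ℕ → G, Tendsto (fun m => δ (α m)⁻¹ ⋆ lam (m + 1)) atTop (𝓝 (haarLaw H hH)) := by
  obtain ⟨β, hβ⟩ := exists_tendsto_of_forall_ultrafilter
    (fun m => continuous_dirac_conv (lam (m + 1)))
    fun U hU => h.exists_tendsto_dirac_conv_ultrafilter hU
  exact ⟨fun m => (β m)⁻¹, by simpa only [inv_inv] using hβ⟩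

lemma tendsto_segConv_conv_dirac (h : IsLimitAlong V μ lam (haarLaw H hH)) {α : ℕ → G}
    (hα : Tendsto (fun m => δ (α m)⁻¹ ⋆ lam (m + 1)) atTop (𝓝 (haarLaw H hH))) (n : ℕ) :
    Tendsto (fun l => segConv μ n l ⋆ δ (α l)) atTop (𝓝 (lam n)) := by
  refine (tendsto_iff_ultrafilter _ _ _).2 fun U hU => ?_
  choose A hA using fun n => exists_tendsto_ultrafilter U fun l => segConv μ n l ⋆ δ (α l)
  have hAH (n : ℕ) : lam n = A n ⋆ haarLaw H hH :=
    h.isConvSolution.eq_conv_of_tendsto hU (hA n) (hα.mono_left hU)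
  obtain ⟨C, hAC, hC⟩ := h.exists_conv_eq (isConvSolution_of_tendsto hU hA) hAH
  have hCH : ∀ᵐ x ∂(C : Measure G), x ∈ H := ae_mem_of_conv_haarLaw_eq hH hC
  have hAlam : A n = lam n := by
    rw [hAC n]
    exact conv_eq_left_of_ae_conv_dirac_eq (hCH.mono fun x hx => h.conv_dirac n hx)
  exact hAlam ▸ hA n

end IsLimitAlong

theorem exists_isLimitTriple {G : Type u} [Group G] [TopologicalSpace G]
    [IsTopologicalGroup G] [CompactSpace G] [T2Space G] [SecondCountableTopology G]
    [MeasurableSpace G] [BorelSpace G] (μ : ℕ → ProbabilityMeasure G) :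
    ∃ (lam : ℕ → ProbabilityMeasure G) (α : ℕ → G) (H : Subgroup G),
      IsLimitTriple.{u, v} μ lam α H := by
  obtain ⟨lam, ν, h⟩ := IsLimitAlong.exists_of_le_atTop Nat.hyperfilter_le_atTop μ
  obtain ⟨H, hH, rfl⟩ := exists_eq_haarLaw_of_conv_self_eq h.conv_self
  obtain ⟨α, hα⟩ := h.exists_tendsto_dirac_conv
  refine ⟨lam, α, H, hH, fun n => ?_, hα, fun n g hg => h.conv_dirac n hg,
    fun _ _ _ _ _ hξ hind hlaw => ae_exists_tendsto_coset hH h.isConvSolution hα hξ hind hlaw⟩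
  have hshift : Tendsto (n + ·) atTop atTop :=
    tendsto_atTop_mono (fun j => Nat.le_add_left j n) tendsto_id
  simpa [Function.comp_def, segConv] using (h.tendsto_segConv_conv_dirac hα n).comp hshift

end Existence

section Uniqueness

variable {G : Type u} [Group G] [TopologicalSpace G] [IsTopologicalGroup G] [T2Space G]
  [SecondCountableTopology G] [MeasurableSpace G] [BorelSpace G]
  {μ lam lam' : ℕ → ProbabilityMeasure G} {α α' : ℕ → G} {H H' : Subgroup G} {g : G}

lemma eq_conj_image_of_haarLaw_eq (hH : IsCompact (H : Set G)) (hH' : IsCompact (H' : Set G))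
    (h : haarLaw H' hH' = δ g⁻¹ ⋆ haarLaw H hH ⋆ δ g) :
    (H' : Set G) = (fun x => g⁻¹ * x * g) '' (H : Set G) := by
  have hmem (x : G) : x ∈ H' ↔ g * x * g⁻¹ ∈ H := by
    rw [← leftStabilizer_haarLaw hH', h, leftStabilizer_conv_dirac, mem_leftStabilizer_dirac_conv,
      inv_inv, leftStabilizer_haarLaw]
  ext x
  refine ⟨fun hx => ⟨_, (hmem x).1 hx, by group⟩, ?_⟩
  rintro ⟨y, hy, rfl⟩
  refine (hmem _).2 ?_
  simpa [mul_assoc] using hy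

theorem IsLimitTriple.unique (h : IsLimitTriple.{u, v} μ lam α H)
    (h' : IsLimitTriple.{u, v} μ lam' α' H')
    (hg : MapClusterPt g atTop fun m => (α m)⁻¹ * α' m) :
    (∀ n, lam' n = lam n ⋆ δ g) ∧ (H' : Set G) = (fun x => g⁻¹ * x * g) '' (H : Set G) := by
  obtain ⟨U, hU, hUg⟩ := mapClusterPt_iff_ultrafilter.1 hg
  have hlam (n : ℕ) : lam' n = lam n ⋆ δ g := by
    have hshift : Tendsto (fun l => l - n) U atTop := (tendsto_sub_atTop_nat n).mono_left hU
    refine tendsto_nhds_unique ((h'.tendsto_conv n).comp hshift)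
      ((tendsto_conv_nhds ((h.tendsto_conv n).comp hshift) (tendsto_dirac hUg)).congr' ?_)
    filter_upwards [hU (eventually_ge_atTop n)] with l hl
    simp only [Function.comp_apply, Nat.add_sub_cancel' hl, conv_assoc, dirac_conv_dirac,
      mul_inv_cancel_left]
  refine ⟨hlam, eq_conj_image_of_haarLaw_eq h.isCompact h'.isCompact ?_⟩
  have hlim := tendsto_conv_nhds
    (tendsto_conv_nhds (tendsto_dirac hUg.inv) (h.tendsto_haar.mono_left hU))
    (tendsto_const_nhds (x := δ g))
  refine tendsto_nhds_unique (h'.tendsto_haar.mono_left hU) (hlim.congr fun m => ?_)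
  rw [hlam, dirac_conv_dirac_conv, mul_inv_rev, inv_inv, mul_inv_cancel_right, conv_assoc]

end Uniqueness

end InfiniteConvolution

theorem mainTheorem3 {G : Type u} [Group G] [TopologicalSpace G] [IsTopologicalGroup G]
    [CompactSpace G] [T2Space G] [SecondCountableTopology G] [MeasurableSpace G] [BorelSpace G]
    (μ : ℕ → ProbabilityMeasure G) :
    (∃ (lam : ℕ → ProbabilityMeasure G) (α : ℕ → G) (H : Subgroup G),
      InfiniteConvolution.IsLimitTriple.{u, v} μ lam α H) ∧
    (∀ (lam lam' : ℕ → ProbabilityMeasure G) (α α' : ℕ → G) (H H' : Subgroup G),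
      InfiniteConvolution.IsLimitTriple.{u, v} μ lam α H →
      InfiniteConvolution.IsLimitTriple.{u, v} μ lam' α' H' →
      ∀ g : G, MapClusterPt g atTop (fun m : ℕ => (α m)⁻¹ * α' m) →
        (∀ n : ℕ, lam' n = InfiniteConvolution.conv (lam n) (diracProba g)) ∧
        (H' : Set G) = (fun h : G => g⁻¹ * h * g) '' (H : Set G)) := by
  exact ⟨InfiniteConvolution.exists_isLimitTriple μ, fun _ _ _ _ _ _ h h' _ hg => h.unique h' hg⟩
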